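/- Let $d,d_k,d',m\ge 1$ and let $\phi:\mathbb R^{d_k}\to\mathbb R^{M}$ be either the Performer feature map $\phi(x)=\frac{e^{-\|x\|_2^2/2}}{\sqrt m}\,[e^{w_1^\top x},\dots,e^{w_m^\top x}]$ for arbitrary fixed $w_1,\dots,w_m\in\mathbb R^{d_k}$ (in particular for every draw $w_r\sim\mathcal N(0,I)$; here $M=m$), or the Linear Transformer feature map $\phi(x)=\mathrm{elu}(x)+1$, taken entrywise (here $M=d_k$), where $\mathrm{elu}(t)=t$ for $t>0$ and $\mathrm{elu}(t)=e^t-1$ for $t\le 0$. For features $X\in\mathbb R^{n^k\times d}$, whose rows are indexed by the $k$-tuples $i\in[n]^k$, and weights $Q,K\in\mathbb R^{d\times d_k}$, $V\in\mathbb R^{d\times d'}$, kernelized order-$k$ attention is $$\mathcal A_k^{\phi}(X)_i=\frac{\big(\phi(X_iQ)^\top\sum_{j\in[n]^k}\phi(X_jK)\otimes(X_jV)\big)^\top}{\phi(X_iQ)^\top\sum_{l\in[n]^k}\phi(X_lK)}\in\mathbb R^{d'}.$$ A virtual tuple attention layer acts on the features $X_i$ of the real tuples together with the feature $x'$ of one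 virtual tuple. It applies input MLPs $Z_i=\theta(X_i)$, $z'=\theta'(x')$ with $Z_i,z'\in\mathbb R^c$; then virtual tuple attention with a residual connection, $$Y_i=Z_i+z'V^2,\qquad y'=z'+\mathrm{softmax}\big((z'Q^1)(ZK^1)^\top\big)ZV^1;$$ then output MLPs $X_i^{\rm new}=\psi(Y_i)$, $x'^{\rm new}=\psi'(y')$. The weight matrices $Q^1,K^1,V^1,V^2$ and the MLPs are parameters, and all real tuples share $\theta$ and $\psi$. The MLPs have affine layers with biases (an affine map is an MLP without hidden layers) and a fixed activation $\sigma$, which is ReLU or any continuous function with limits $0$ at $-\infty$ and $1$ at $+\infty$. The width of a network is the largest dimension occurring in it. Claim: virtual tuple attention of $O(1)$ depth and $O(1)$ width approximates $\mathcal A_k^{\phi}$ arbitrarily well on bounded inputs. Precisely, for all $C_1,C_2\in\mathbb R$ and $\varepsilon>0$ there is $W\in\mathbb N$, depending only on $\sigma,d,d',\phi,C_1,C_2,\varepsilon$, such that for all $Q,K,V$ of spectral norm less than $C_2$ there is a network of exactly two virtual tuple attention layers, all of whose MLPs have at most one hidden layer, of width at most $W$, such that for all $k,n$, all $X\in\mathbb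 R^{n^k\times d}$ with $\|X_i\|_2<C_1$ for every $i\in[n]^k$, and all initial virtual features $x'\in\mathbb R^d$, the output of the network at each real tuple $i\in[n]^k$ differs from $\mathcal A_k^{\phi}(X)_i$ by less than $\varepsilon$ in Euclidean norm. -/

import Mathlib

open scoped Matrix Matrix.Norms.L2Operator

noncomputable section

/-- Order-`k` tuples of `n` nodes, the `n ^ k` tokens. -/
abbrev Tup (k n : ℕ) : Type := Fin k → Fin n

/-- The Euclidean norm of a feature vector. -/
def l2norm {d : ℕ} (x : Fin d → ℝ) : ℝ := ‖WithLp.toLp 2 x‖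

/-! ### Kernelized order-`k` attention -/

/-- The exponential linear unit. -/
def elu (t : ℝ) : ℝ := if 0 < t then t else Real.exp t - 1

/-- Linear Transformer feature map `φ(x) = elu(x) + 1`, entrywise. -/
def linearFeature {p : ℕ} (x : Fin p → ℝ) : Fin p → ℝ := fun a => elu (x a) + 1

/-- Performer feature map with projection vectors `w 0, …, w (m - 1)`:
`φ(x) = exp(-‖x‖² / 2) / √m * [exp(w₁ᵀ x), …, exp(wₘᵀ x)]`. -/
def performerFeature {p m : ℕ} (w : Fin m → Fin p → ℝ) (x : Fin p → ℝ) : Fin m → ℝ :=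
  fun a => Real.exp (-(l2norm x ^ 2 / 2)) / Real.sqrt m * Real.exp (w a ⬝ᵥ x)

/-- Kernelized attention with feature map `φ`: the output at token `i` is
`(φ(Xᵢ Q)ᵀ ∑ⱼ φ(Xⱼ K) ⊗ (Xⱼ V))ᵀ / (φ(Xᵢ Q)ᵀ ∑ₗ φ(Xₗ K))`. -/
def kernelAttention {k n d p m d' : ℕ} (φ : (Fin p → ℝ) → Fin m → ℝ)
    (Q K : Matrix (Fin d) (Fin p) ℝ) (V : Matrix (Fin d) (Fin d') ℝ)
    (X : Tup k n → Fin d → ℝ) (i : Tup k n) : Fin d' → ℝ := fun c =>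
  (φ (X i ᵥ* Q) ᵥ* ∑ j, Matrix.vecMulVec (φ (X j ᵥ* K)) (X j ᵥ* V)) c /
    (φ (X i ᵥ* Q) ⬝ᵥ ∑ l, φ (X l ᵥ* K))

/-! ### Multilayer perceptrons -/

/-- Admissible activation functions: ReLU, and every continuous sigmoidal function. -/
def IsActivation (σ : ℝ → ℝ) : Prop :=
  σ = (fun t => max t 0) ∨
    (Continuous σ ∧ Filter.Tendsto σ Filter.atBot (nhds 0) ∧
      Filter.Tendsto σ Filter.atTop (nhds 1))

/-- Parameters of a multilayer perceptron from `ℝ^a` to `ℝ^b`. -/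
inductive Mlp : ℕ → ℕ → Type
  /-- The output layer, an affine map. -/
  | out {a b : ℕ} (A : Matrix (Fin a) (Fin b) ℝ) (β : Fin b → ℝ) : Mlp a b
  /-- A hidden layer with `h` neurons, followed by the rest of the perceptron. -/
  | hidden {a h b : ℕ} (A : Matrix (Fin a) (Fin h) ℝ) (β : Fin h → ℝ) (rest : Mlp h b) : Mlp a b

namespace Mlp

/-- The function computed with activation `σ`. -/
def eval (σ : ℝ → ℝ) : {a b : ℕ} → Mlp a b → (Fin a → ℝ) → Fin b → ℝ
  | _, _, out A β, x => x ᵥ* A + β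
  | _, _, hidden A β rest, x => eval σ rest (fun r => σ ((x ᵥ* A + β) r))

/-- The number of hidden layers. -/
def depth : {a b : ℕ} → Mlp a b → ℕ
  | _, _, out _ _ => 0
  | _, _, hidden _ _ rest => depth rest + 1

/-- The largest dimension of the input, the hidden layers and the output. -/
def width : {a b : ℕ} → Mlp a b → ℕ
  | a, b, out _ _ => max a b
  | a, _, hidden _ _ rest => max a (width rest)

end Mlp

/-! ### Virtual tuple attention -/

/-- The row softmax. -/
def softmax {ι : Type*} [Fintype ι] (s : ι → ℝ) (i : ι) : ℝ :=
  Real.exp (s i) / ∑ j, Real.exp (s j)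

/-- Virtual tuple attention at the virtual tuple: `softmax ((x' Q¹) (X K¹)ᵀ) X V¹`. -/
def vtAttentionVirtual {k n c p e : ℕ} (Q₁ K₁ : Matrix (Fin c) (Fin p) ℝ)
    (V₁ : Matrix (Fin c) (Fin e) ℝ) (X : Tup k n → Fin c → ℝ) (x' : Fin c → ℝ) : Fin e → ℝ :=
  ∑ j, softmax (fun l => (x' ᵥ* Q₁) ⬝ᵥ (X l ᵥ* K₁)) j • (X j ᵥ* V₁)

/-- Virtual tuple attention at each real tuple: `x' V²`. -/
def vtAttentionReal {c e : ℕ} (V₂ : Matrix (Fin c) (Fin e) ℝ) (x' : Fin c → ℝ) : Fin e → ℝ :=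
  x' ᵥ* V₂

/-- Parameters of a virtual tuple attention layer with input and output perceptrons. All real
tuples share the same perceptrons, the virtual tuple has its own ones. -/
structure VTLayer (a b : ℕ) : Type where
  /-- feature dimension inside the layer -/
  c : ℕ
  /-- query and key dimension -/
  p : ℕ
  inReal : Mlp a c
  inVirtual : Mlp a c
  Q₁ : Matrix (Fin c) (Fin p) ℝ
  K₁ : Matrix (Fin c) (Fin p) ℝ
  V₁ : Matrix (Fin c) (Fin c) ℝ
  V₂ : Matrix (Fin c) (Fin c) ℝ
  outReal : Mlp c b
  outVirtual : Mlp c b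

namespace VTLayer

/-- Input perceptrons, then attention with a residual connection, then output perceptrons. The
state is the pair of the features of the real tuples and the feature of the virtual tuple. -/
def eval (σ : ℝ → ℝ) {k n a b : ℕ} (L : VTLayer a b)
    (S : (Tup k n → Fin a → ℝ) × (Fin a → ℝ)) : (Tup k n → Fin b → ℝ) × (Fin b → ℝ) :=
  let Z : Tup k n → Fin L.c → ℝ := fun i => L.inReal.eval σ (S.1 i)
  let z' : Fin L.c → ℝ := L.inVirtual.eval σ S.2
  (fun i => L.outReal.eval σ (Z i + vtAttentionReal L.V₂ z'),
    L.outVirtual.eval σ (z' + vtAttentionVirtual L.Q₁ L.K₁ L.V₁ Z z'))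

/-- The largest number of hidden layers of a perceptron of the layer. -/
def mlpDepth {a b : ℕ} (L : VTLayer a b) : ℕ :=
  max (max L.inReal.depth L.inVirtual.depth) (max L.outReal.depth L.outVirtual.depth)

/-- The largest dimension that occurs in the layer. -/
def width {a b : ℕ} (L : VTLayer a b) : ℕ :=
  max L.p (max (max L.inReal.width L.inVirtual.width) (max L.outReal.width L.outVirtual.width))

end VTLayer

/-- Virtual tuple attention networks: finite compositions of virtual tuple attention layers. -/
inductive VTNet : ℕ → ℕ → Type
  | nil {a : ℕ} : VTNet a a
  | cons {a b c : ℕ} (L : VTLayer a b) (N : VTNet b c) : VTNet a c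

namespace VTNet

/-- The function computed by the network on the real tuples and the virtual tuple. -/
def eval (σ : ℝ → ℝ) {k n : ℕ} : {a b : ℕ} → VTNet a b →
    (Tup k n → Fin a → ℝ) × (Fin a → ℝ) → (Tup k n → Fin b → ℝ) × (Fin b → ℝ)
  | _, _, nil, S => S
  | _, _, cons L N, S => eval σ N (L.eval σ S)

/-- The number of attention layers. -/
def numLayers : {a b : ℕ} → VTNet a b → ℕ
  | _, _, nil => 0
  | _, _, cons _ N => numLayers N + 1

/-- The largest number of hidden layers of a perceptron in the network. -/
def mlpDepth : {a b : ℕ} → VTNet a b → ℕ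
  | _, _, nil => 0
  | _, _, cons L N => max L.mlpDepth (mlpDepth N)

/-- The largest dimension that occurs in the network. -/
def width : {a b : ℕ} → VTNet a b → ℕ
  | a, _, nil => a
  | _, _, cons L N => max L.width (width N)

end VTNet

/-- Kernelized order-`k` attention with feature map `φ`, from feature dimension `d` to `d'`, is
approximated arbitrarily well by virtual tuple attention of constant depth and width: the width
bound `W` depends only on `σ`, `φ`, `d`, `d'`, the bounds `C₁`, `C₂` and the accuracy `ε`, and one
network serves all orders `k`, all numbers `n` of nodes, all inputs `X` with `‖Xᵢ‖ < C₁` and all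
initial features `x'` of the virtual tuple. -/
def ApproximableByVT (σ : ℝ → ℝ) (d d' : ℕ) {p m : ℕ} (φ : (Fin p → ℝ) → Fin m → ℝ) : Prop :=
  ∀ C₁ C₂ ε : ℝ, 0 < ε → ∃ W : ℕ,
    ∀ (Q K : Matrix (Fin d) (Fin p) ℝ) (V : Matrix (Fin d) (Fin d') ℝ),
      ‖Q‖ < C₂ → ‖K‖ < C₂ → ‖V‖ < C₂ →
        ∃ N : VTNet d d', N.numLayers = 2 ∧ N.mlpDepth ≤ 1 ∧ N.width ≤ W ∧
          ∀ (k n : ℕ) (X : Tup k n → Fin d → ℝ) (x' : Fin d → ℝ),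
            (∀ i, l2norm (X i) < C₁) →
              ∀ i, l2norm ((N.eval σ (X, x')).1 i - kernelAttention φ Q K V X i) < ε

end

/-! Dividing numerator and denominator by the number of tokens turns kernelized attention into a
fixed function of `φ(XᵢQ)` and of the token averages of `φ(XⱼK)` and `φ(XⱼK) ⊗ XⱼV`. Both feature
maps are continuous and entrywise positive, so on bounded inputs the denominator stays above some `δ
> 0`, and the quotient extends to a continuous function (`kernelAttention_eq_attentionQuotient`).

Two layers compute such averages exactly: zero queries and keys make the softmax uniform, the
virtual tuple collects the mean, and the second layer broadcasts it (`averagingNet_eval`). Only the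
tokenwise features and the final quotient are approximated, each by one hidden layer
(`IsActivation.exists_hidden_near`). Averaging does not amplify sup-norm errors, so nothing depends
on `n` or `k`; the weights `Q`, `K`, `V` enter only through a linear map absorbed into the first
layer, so the width does not depend on them (`IsActivation.exists_vtNet_near`). -/

noncomputable section

/-! ### Universal approximation by perceptrons with one hidden layer -/

/-- If `τ` is close to the unit step away from `0`, a function of oscillation at most `δ` on unit
intervals is close to the sum of shifts of `τ` weighted by its increments. -/
theorem abs_sub_sum_increments_le {f τ : ℝ → ℝ} {N : ℕ} {δ M : ℝ} (hM : ∀ s, |τ s| ≤ M)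
    (hlow : ∀ s ≤ -(1 / 2), |τ s| ≤ 1 / N) (hhigh : ∀ s, 1 / 2 ≤ s → |τ s - 1| ≤ 1 / N)
    (hf : ∀ x ∈ Set.Icc (0 : ℝ) N, ∀ y ∈ Set.Icc (0 : ℝ) N, |x - y| ≤ 1 → |f x - f y| ≤ δ)
    {t : ℝ} (ht0 : 0 ≤ t) (htN : t < N) :
    |f t - (f 0 + ∑ j ∈ Finset.range N, (f (j + 1 : ℕ) - f j) * τ (t - j - 1 / 2))|
      ≤ δ * (M + 3) := by
  set J := ⌊t⌋₊ with hJ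
  have hJt : (J : ℝ) ≤ t := Nat.floor_le ht0
  have htJ : t < J + 1 := Nat.lt_floor_add_one t
  have hJN : J < N := by exact_mod_cast hJt.trans_lt htN
  have hN : (0 : ℝ) < N := ht0.trans_lt htN
  have hδ : 0 ≤ δ := (abs_nonneg _).trans (hf t ⟨ht0, htN.le⟩ t ⟨ht0, htN.le⟩ (by simp))
  have hM0 : 0 ≤ M := (abs_nonneg _).trans (hM 0)
  -- With exact unit steps the sum telescopes to the value at the grid point `J = ⌊t⌋`.
  have htel : ∑ j ∈ Finset.range N, (f (j + 1 : ℕ) - f j) * (if j < J then 1 else 0)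
      = f J - f 0 := by
    have h1 : ∑ j ∈ Finset.range J, (f (j + 1 : ℕ) - f j) = f J - f 0 := by
      simpa using Finset.sum_range_sub (fun j : ℕ => f j) J
    rw [← h1]
    simp only [mul_ite, mul_one, mul_zero]
    rw [← Finset.sum_filter]
    refine Finset.sum_congr ?_ fun _ _ => rfl
    ext j
    simp only [Finset.mem_filter, Finset.mem_range]
    omega
  -- Only for `j = J` can the argument of `τ` lie within `1/2` of the jump; there the crude bound
  -- `M` is used. The other errors, at most `1 / N` each, add up to at most `1`.
  have hterm : ∀ j ∈ Finset.range N,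
      |(f (j + 1 : ℕ) - f j) * (τ (t - j - 1 / 2) - (if j < J then 1 else 0))|
        ≤ δ * (1 / N + if j = J then M + 1 else 0) := by
    intro j hj
    have hjN : j + 1 ≤ N := Finset.mem_range.1 hj
    have hjN' : (j : ℝ) + 1 ≤ N := by exact_mod_cast hjN
    have hΔ : |f (j + 1 : ℕ) - f j| ≤ δ := by
      refine hf _ ⟨by positivity, by exact_mod_cast hjN⟩ _ ⟨by positivity, by linarith⟩ ?_
      simp
    rw [abs_mul]
    refine mul_le_mul hΔ ?_ (abs_nonneg _) hδ
    rcases lt_trichotomy j J with h | h | h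
    · have : (j : ℝ) + 1 ≤ J := by exact_mod_cast h
      rw [if_pos h, if_neg h.ne, add_zero]
      exact hhigh _ (by linarith)
    · rw [if_neg h.not_lt, if_pos h, sub_zero]
      have := hM (t - j - 1 / 2)
      have : (0 : ℝ) ≤ 1 / N := by positivity
      linarith
    · have : (J : ℝ) + 1 ≤ j := by exact_mod_cast h
      rw [if_neg h.not_gt, if_neg h.ne', add_zero, sub_zero]
      exact hlow _ (by linarith)
  have hsum : |∑ j ∈ Finset.range N,
      (f (j + 1 : ℕ) - f j) * (τ (t - j - 1 / 2) - (if j < J then 1 else 0))| ≤ δ * (M + 2) := by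
    refine (Finset.abs_sum_le_sum_abs _ _).trans ((Finset.sum_le_sum hterm).trans_eq ?_)
    rw [← Finset.mul_sum, Finset.sum_add_distrib, Finset.sum_const, Finset.card_range,
      Finset.sum_ite_eq', if_pos (Finset.mem_range.2 hJN), nsmul_eq_mul]
    field_simp
    ring
  have hlast : |f t - f J| ≤ δ := by
    refine hf _ ⟨ht0, htN.le⟩ _ ⟨by positivity, by linarith⟩ ?_
    rw [abs_le]
    constructor <;> linarith
  simp only [mul_sub, Finset.sum_sub_distrib] at hsum
  rw [htel] at hsum
  rw [abs_le] at *
  constructor <;> linarith [hsum.1, hsum.2, hlast.1, hlast.2]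

/-- A continuous sigmoidal function is bounded. -/
theorem exists_abs_le_of_sigmoidal {σ : ℝ → ℝ} (hc : Continuous σ)
    (h0 : Filter.Tendsto σ Filter.atBot (nhds 0)) (h1 : Filter.Tendsto σ Filter.atTop (nhds 1)) :
    ∃ M, ∀ s, |σ s| ≤ M := by
  obtain ⟨a, ha⟩ := Filter.eventually_atBot.1 (h0.abs.eventually_lt_const (u := 2) (by simp))
  obtain ⟨b, hb⟩ := Filter.eventually_atTop.1 (h1.abs.eventually_lt_const (u := 2) (by simp))
  obtain ⟨M, hM⟩ := (isCompact_Icc (a := a) (b := b)).exists_bound_of_continuousOn hc.continuousOn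
  refine ⟨max M 2, fun s => ?_⟩
  rcases le_total s a with h | h
  · exact (ha s h).le.trans (le_max_right _ _)
  rcases le_total s b with h' | h'
  · exact (hM s ⟨h, h'⟩).trans (le_max_left _ _)
  · exact (hb s h').le.trans (le_max_right _ _)

/-- Univariate universal approximation with a continuous sigmoidal activation. -/
theorem exists_sum_sigmoidal_near {σ : ℝ → ℝ} (hc : Continuous σ)
    (h0 : Filter.Tendsto σ Filter.atBot (nhds 0)) (h1 : Filter.Tendsto σ Filter.atTop (nhds 1))
    {f : ℝ → ℝ} (hf : Continuous f) {R ε : ℝ} (hR : 0 ≤ R) (hε : 0 < ε) :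
    ∃ (N : ℕ) (c₀ : ℝ) (a : ℝ) (b c : ℕ → ℝ), ∀ t, |t| ≤ R →
      |f t - (c₀ + ∑ j ∈ Finset.range N, c j * σ (a * t + b j))| ≤ ε := by
  obtain ⟨M, hM⟩ := exists_abs_le_of_sigmoidal hc h0 h1
  have hM0 : 0 ≤ M := (abs_nonneg _).trans (hM 0)
  have huc := (isCompact_Icc (a := -R) (b := R + 2)).uniformContinuousOn_of_continuous
    hf.continuousOn
  obtain ⟨δ, hδ, hfδ⟩ := Metric.uniformContinuousOn_iff_le.1 huc (ε / (M + 3)) (by positivity)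
  -- `N` serves twice: it makes the mesh at most `δ`, and `1 / N` is the required accuracy of the
  -- steps. The grid ends at `R + 2`, beyond `R`, so that `(t + R) / h < N` holds strictly.
  obtain ⟨N, hN⟩ := exists_nat_gt ((2 * R + 2) / δ)
  have hN0 : (0 : ℝ) < N := lt_of_le_of_lt (by positivity) hN
  set h : ℝ := (2 * R + 2) / N with hh
  have hpos : 0 < h := by positivity
  have hhN : h * N = 2 * R + 2 := by rw [hh]; field_simp
  have hhδ : h ≤ δ := by
    rw [hh, div_le_iff₀ hN0]
    rw [div_lt_iff₀ hδ] at hN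
    linarith
  have hNinv : (0 : ℝ) < 1 / N := by positivity
  obtain ⟨A, hA⟩ := Filter.eventually_atBot.1
    (h0.eventually (Metric.closedBall_mem_nhds _ hNinv))
  obtain ⟨B, hB⟩ := Filter.eventually_atTop.1
    (h1.eventually (Metric.closedBall_mem_nhds _ hNinv))
  -- Steep enough that `|s| ≥ 1/2` sends `l * s` below `A` or above `B`.
  set l : ℝ := 2 * (|A| + |B|) with hl
  have key := fun t ht0 htN => abs_sub_sum_increments_le (f := fun u => f (-R + h * u))
    (τ := fun s => σ (l * s)) (N := N) (δ := ε / (M + 3)) (M := M) (fun s => hM _)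
    (fun s hs => by
      have : l * s ≤ A := by
        have := neg_abs_le A
        have := mul_le_mul_of_nonneg_left hs (show 0 ≤ l by positivity)
        linarith [abs_nonneg B]
      simpa [Real.dist_eq] using hA _ this)
    (fun s hs => by
      have : B ≤ l * s := by
        have := le_abs_self B
        have := mul_le_mul_of_nonneg_left hs (show 0 ≤ l by positivity)
        linarith [abs_nonneg A]
      simpa [Real.dist_eq] using hB _ this)
    (fun x hx y hy hxy => by
      have hmem : ∀ z ∈ Set.Icc (0 : ℝ) N, -R + h * z ∈ Set.Icc (-R) (R + 2) := by
        intro z hz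
        have := mul_le_mul_of_nonneg_left hz.2 hpos.le
        have := mul_nonneg hpos.le hz.1
        constructor <;> linarith
      refine hfδ _ (hmem x hx) _ (hmem y hy) ?_
      rw [Real.dist_eq, show -R + h * x - (-R + h * y) = h * (x - y) by ring, abs_mul,
        abs_of_pos hpos]
      exact (mul_le_of_le_one_right hpos.le hxy).trans hhδ) (t := t) ht0 htN
  refine ⟨N, f (-R), l / h, fun j => l * (R / h - j - 1 / 2),
    fun j => f (-R + h * (j + 1 : ℕ)) - f (-R + h * j), fun t ht => ?_⟩
  rw [abs_le] at ht
  have h3 := key ((t + R) / h) (div_nonneg (by linarith) hpos.le)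
    (by rw [div_lt_iff₀ hpos, mul_comm]; linarith)
  rw [div_mul_cancel₀ _ (by positivity : M + 3 ≠ 0)] at h3
  have e1 : -R + h * ((t + R) / h) = t := by field_simp; ring
  have e2 : ∀ j : ℕ, l / h * t + l * (R / h - j - 1 / 2) = l * ((t + R) / h - j - 1 / 2) := by
    intro j; field_simp; ring
  simpa only [e1, e2, mul_zero, add_zero] using h3

/-! ### From one variable to several: Stone–Weierstrass with exponentials of linear forms -/

section Shallow

variable {α : Type} [Fintype α]

/-- The functions computed by perceptrons with one hidden layer and a single output. -/
def shallowSpan (σ : ℝ → ℝ) (α : Type) [Fintype α] : Submodule ℝ ((α → ℝ) → ℝ) :=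
  Submodule.span ℝ (insert 1 (Set.range fun q : (α → ℝ) × ℝ => fun x => σ (q.1 ⬝ᵥ x + q.2)))

theorem one_mem_shallowSpan (σ : ℝ → ℝ) : (1 : (α → ℝ) → ℝ) ∈ shallowSpan σ α :=
  Submodule.subset_span (Set.mem_insert _ _)

theorem neuron_mem_shallowSpan (σ : ℝ → ℝ) (w : α → ℝ) (b : ℝ) :
    (fun x => σ (w ⬝ᵥ x + b)) ∈ shallowSpan σ α :=
  Submodule.subset_span (Set.mem_insert_of_mem _ ⟨(w, b), rfl⟩)

/-- The functions that are uniform limits on `s` of functions in `P`. -/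
def uniformLimits (P : Submodule ℝ ((α → ℝ) → ℝ)) (s : Set (α → ℝ)) :
    Submodule ℝ ((α → ℝ) → ℝ) where
  carrier := {f | ∀ ε > 0, ∃ g ∈ P, ∀ x ∈ s, |f x - g x| ≤ ε}
  zero_mem' := fun ε hε => ⟨0, P.zero_mem, fun x _ => by simpa using hε.le⟩
  add_mem' := by
    intro f₁ f₂ h₁ h₂ ε hε
    obtain ⟨g₁, hg₁, h₁⟩ := h₁ (ε / 2) (half_pos hε)
    obtain ⟨g₂, hg₂, h₂⟩ := h₂ (ε / 2) (half_pos hε)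
    refine ⟨g₁ + g₂, P.add_mem hg₁ hg₂, fun x hx => ?_⟩
    have e : (f₁ + f₂) x - (g₁ + g₂) x = (f₁ x - g₁ x) + (f₂ x - g₂ x) := by
      simp only [Pi.add_apply]; ring
    rw [e]
    linarith [abs_add_le (f₁ x - g₁ x) (f₂ x - g₂ x), h₁ x hx, h₂ x hx]
  smul_mem' := by
    intro r f h ε hε
    obtain ⟨g, hg, h⟩ := h (ε / (|r| + 1)) (by positivity)
    refine ⟨r • g, P.smul_mem r hg, fun x hx => ?_⟩
    have e : (r • f) x - (r • g) x = r * (f x - g x) := by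
      simp only [Pi.smul_apply, smul_eq_mul]; ring
    rw [e, abs_mul]
    have h2 := h x hx
    rw [le_div_iff₀ (by positivity)] at h2
    nlinarith [abs_nonneg (f x - g x)]

/-- Exponentials of linear forms are uniform limits of shallow networks. -/
theorem exp_dotProduct_mem_uniformLimits {σ : ℝ → ℝ} (hc : Continuous σ)
    (h0 : Filter.Tendsto σ Filter.atBot (nhds 0)) (h1 : Filter.Tendsto σ Filter.atTop (nhds 1))
    {s : Set (α → ℝ)} (hs : IsCompact s) (w : α → ℝ) :
    (fun x => Real.exp (w ⬝ᵥ x)) ∈ uniformLimits (shallowSpan σ α) s := by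
  intro ε hε
  obtain ⟨R, hR⟩ := hs.exists_bound_of_continuousOn (f := fun x => w ⬝ᵥ x)
    (by unfold dotProduct; fun_prop)
  obtain ⟨N, c₀, a, b, c, H⟩ := exists_sum_sigmoidal_near hc h0 h1 Real.continuous_exp
    (abs_nonneg R) hε
  refine ⟨c₀ • 1 + ∑ j ∈ Finset.range N, c j • fun x => σ ((a • w) ⬝ᵥ x + b j),
    Submodule.add_mem _ (Submodule.smul_mem _ _ (one_mem_shallowSpan σ))
      (Submodule.sum_mem _ fun j _ => Submodule.smul_mem _ _ (neuron_mem_shallowSpan σ _ _)),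
    fun x hx => ?_⟩
  have := H (w ⬝ᵥ x) ((hR x hx).trans (le_abs_self R))
  simpa [Finset.sum_apply, smul_dotProduct] using this

/-- The exponential of a linear form, as a homomorphism into the continuous functions. -/
def expHom (α : Type) [Fintype α] : Multiplicative (α → ℝ) →* C(α → ℝ, ℝ) where
  toFun w := ⟨fun x => Real.exp (Multiplicative.toAdd w ⬝ᵥ x), by unfold dotProduct; fun_prop⟩
  map_one' := by ext x; simp
  map_mul' v w := by ext x; simp [add_dotProduct, Real.exp_add]

/-- The subalgebra spanned by the exponentials of linear forms separates points. -/
theorem separatesPoints_adjoin_expHom :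
    (Algebra.adjoin ℝ (Set.range (expHom α))).SeparatesPoints := by
  classical
  intro x y hxy
  obtain ⟨i, hi⟩ := Function.ne_iff.1 hxy
  refine ⟨expHom α (Multiplicative.ofAdd (Pi.single i 1)),
    ⟨_, Algebra.subset_adjoin ⟨_, rfl⟩, rfl⟩, ?_⟩
  simpa [expHom] using hi

/-- Stone–Weierstrass reduces the claim to exponentials of linear forms, which are univariate
functions of `w ⬝ᵥ x`. -/
theorem mem_uniformLimits_of_sigmoidal {σ : ℝ → ℝ} (hc : Continuous σ)
    (h0 : Filter.Tendsto σ Filter.atBot (nhds 0)) (h1 : Filter.Tendsto σ Filter.atTop (nhds 1))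
    {s : Set (α → ℝ)} (hs : IsCompact s) {f : (α → ℝ) → ℝ} (hf : Continuous f) :
    f ∈ uniformLimits (shallowSpan σ α) s := by
  intro ε hε
  obtain ⟨g, hg, hgf⟩ :=
    ContinuousMap.exists_mem_subalgebra_near_continuous_of_isCompact_of_separatesPoints
      (separatesPoints_adjoin_expHom (α := α)) ⟨f, hf⟩ hs (half_pos hε)
  have hg' : (g : (α → ℝ) → ℝ) ∈ uniformLimits (shallowSpan σ α) s := by
    -- Products of these exponentials are again such exponentials, so the algebra they generate is
    -- just their linear span.
    have hspan : g ∈ Submodule.span ℝ (Set.range (expHom α)) := by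
      have : g ∈ Subalgebra.toSubmodule (Algebra.adjoin ℝ (Set.range (expHom α))) := hg
      rwa [Algebra.adjoin_eq_span, ← MonoidHom.coe_mrange, Submonoid.closure_eq] at this
    clear hg hgf
    induction hspan using Submodule.span_induction with
    | mem x hx =>
      obtain ⟨w, rfl⟩ := hx
      exact exp_dotProduct_mem_uniformLimits hc h0 h1 hs (Multiplicative.toAdd w)
    | zero => exact Submodule.zero_mem _
    | add x y _ _ hx hy => exact Submodule.add_mem _ hx hy
    | smul r x _ hx => exact Submodule.smul_mem _ r hx
  obtain ⟨k, hk, hkg⟩ := hg' (ε / 2) (half_pos hε)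
  refine ⟨k, hk, fun x hx => ?_⟩
  have h2 := hgf x hx
  have h3 := hkg x hx
  rw [Real.norm_eq_abs, abs_sub_comm] at h2
  simp only [ContinuousMap.coe_mk] at h2
  linarith [abs_sub_le (f x) (g x) (k x)]

/-- Networks whose activation is a difference of two rectified linear units are ReLU networks. -/
theorem shallowSpan_relu_sub_le :
    shallowSpan (fun t => max (t + 1) 0 - max t 0) α ≤ shallowSpan (fun t => max t 0) α := by
  refine Submodule.span_le.2 (Set.insert_subset (one_mem_shallowSpan _) ?_)
  rintro _ ⟨⟨w, b⟩, rfl⟩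
  have := Submodule.sub_mem _ (neuron_mem_shallowSpan (fun t => max t 0) w (b + 1))
    (neuron_mem_shallowSpan (fun t => max t 0) w b)
  simp only [← add_assoc, Pi.sub_def] at this
  exact this

/-- Universal approximation of real functions by shallow networks. -/
theorem IsActivation.mem_uniformLimits {σ : ℝ → ℝ} (hσ : IsActivation σ)
    {s : Set (α → ℝ)} (hs : IsCompact s) {f : (α → ℝ) → ℝ} (hf : Continuous f) :
    f ∈ uniformLimits (shallowSpan σ α) s := by
  rcases hσ with rfl | ⟨hc, h0, h1⟩
  · intro ε hε
    -- The difference of two shifted ReLUs is a ramp from `0` to `1`, hence continuous and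
    -- sigmoidal.
    obtain ⟨g, hg, h⟩ := mem_uniformLimits_of_sigmoidal
      (σ := fun t => max (t + 1) 0 - max t 0) (by fun_prop)
      (tendsto_const_nhds.congr' (by
        filter_upwards [Filter.eventually_le_atBot (-1)] with t ht
        rw [max_eq_right (by linarith), max_eq_right (by linarith), sub_zero]))
      (tendsto_const_nhds.congr' (by
        filter_upwards [Filter.eventually_ge_atTop 0] with t ht
        rw [max_eq_left (by linarith), max_eq_left ht]; ring)) hs hf ε hε
    exact ⟨g, shallowSpan_relu_sub_le hg, h⟩
  · exact mem_uniformLimits_of_sigmoidal hc h0 h1 hs hf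

theorem exists_neurons_of_mem_shallowSpan {σ : ℝ → ℝ} {g : (α → ℝ) → ℝ}
    (hg : g ∈ shallowSpan σ α) :
    ∃ (ι : Type) (_ : Fintype ι) (w : ι → α → ℝ) (b c : ι → ℝ) (c₀ : ℝ),
      ∀ x, g x = ∑ r, σ (x ⬝ᵥ w r + b r) * c r + c₀ := by
  induction hg using Submodule.span_induction with
  | mem x hx =>
    rcases hx with rfl | ⟨⟨w, b⟩, rfl⟩
    · exact ⟨Empty, inferInstance, nofun, nofun, nofun, 1, by simp⟩
    · exact ⟨Unit, inferInstance, fun _ => w, fun _ => b, fun _ => 1, 0,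
        fun x => by simp [dotProduct_comm]⟩
  | zero => exact ⟨Empty, inferInstance, nofun, nofun, nofun, 0, by simp⟩
  | add f g _ _ hf hg =>
    obtain ⟨ι, _, w, b, c, c₀, h⟩ := hf
    obtain ⟨ι', _, w', b', c', c₀', h'⟩ := hg
    refine ⟨ι ⊕ ι', inferInstance, Sum.elim w w', Sum.elim b b', Sum.elim c c', c₀ + c₀',
      fun x => ?_⟩
    rw [Pi.add_apply, h, h', Fintype.sum_sum_type]
    simp only [Sum.elim_inl, Sum.elim_inr]
    ring
  | smul r f _ hf =>
    obtain ⟨ι, _, w, b, c, c₀, h⟩ := hf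
    refine ⟨ι, inferInstance, w, b, fun i => r * c i, r * c₀, fun x => ?_⟩
    rw [Pi.smul_apply, h, smul_eq_mul, mul_add, Finset.mul_sum]
    congr 1
    exact Finset.sum_congr rfl fun i _ => by ring

/-- Universal approximation by one hidden layer: a continuous map is uniformly approximated on
compact sets. -/
theorem IsActivation.exists_hidden_near {σ : ℝ → ℝ} (hσ : IsActivation σ) {γ : Type} [Fintype γ]
    {s : Set (α → ℝ)} (hs : IsCompact s) {f : (α → ℝ) → γ → ℝ} (hf : Continuous f)
    {ε : ℝ} (hε : 0 < ε) :
    ∃ (h : ℕ) (A : Matrix α (Fin h) ℝ) (β : Fin h → ℝ) (C : Matrix (Fin h) γ ℝ) (β' : γ → ℝ),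
      ∀ x ∈ s, ‖((fun r => σ ((x ᵥ* A + β) r)) ᵥ* C + β') - f x‖ ≤ ε := by
  classical
  choose g hg hfg using fun o : γ =>
    hσ.mem_uniformLimits hs ((continuous_apply o).comp hf) ε hε
  choose ι inst w b c c₀ H using fun o : γ => exists_neurons_of_mem_shallowSpan (hg o)
  let e : Fin (Fintype.card (Σ o, ι o)) ≃ Σ o, ι o := (Fintype.equivFin _).symm
  -- The neurons of all output coordinates are placed side by side; each output reads only its own
  -- block.
  refine ⟨Fintype.card (Σ o, ι o), Matrix.of fun a r => w (e r).1 (e r).2 a,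
    fun r => b (e r).1 (e r).2,
    Matrix.of fun r o => if (e r).1 = o then c (e r).1 (e r).2 else 0, c₀, fun x hx => ?_⟩
  rw [pi_norm_le_iff_of_nonneg hε.le]
  intro o
  have h1 := hfg o x hx
  rw [abs_sub_comm, H o x] at h1
  refine le_trans (le_of_eq ?_) h1
  rw [Real.norm_eq_abs]
  congr 1
  change _ + c₀ o - f x o = _ + c₀ o - f x o
  congr 2
  refine (e.sum_comp fun q : Σ o, ι o => σ (x ⬝ᵥ w q.1 q.2 + b q.1 q.2) *
    if q.1 = o then c q.1 q.2 else 0).trans ?_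
  rw [Fintype.sum_sigma, Finset.sum_eq_single o]
  · simp
  · intro o' _ ho'
    simp [ho']
  · simp

end Shallow

/-! ### Networks that average over all tokens -/

/-- Keep the coordinates of token `i` that satisfy `P`, average the others over all tokens. -/
def tokenMix {k n : ℕ} {γ : Type} (P : γ → Prop) [DecidablePred P] (Y : Tup k n → γ → ℝ)
    (i : Tup k n) : γ → ℝ :=
  fun a => if P a then Y i a else (Fintype.card (Tup k n) : ℝ)⁻¹ * ∑ j, Y j a

section TokenMix

variable {k n : ℕ} {γ : Type} (P : γ → Prop) [DecidablePred P]

theorem tokenMix_sub (Y Y' : Tup k n → γ → ℝ) (i : Tup k n) :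
    tokenMix P (fun j => Y j - Y' j) i = tokenMix P Y i - tokenMix P Y' i := by
  ext a
  simp only [tokenMix, Pi.sub_apply, Finset.sum_sub_distrib]
  split_ifs <;> ring

/-- Averaging is nonexpansive in the sup norm, whatever the number of tokens; this makes the final
error uniform in `n` and `k`. -/
theorem norm_tokenMix_le [Fintype γ] {Y : Tup k n → γ → ℝ} {r : ℝ} (h : ∀ j, ‖Y j‖ ≤ r)
    (i : Tup k n) : ‖tokenMix P Y i‖ ≤ r := by
  have hr : 0 ≤ r := (norm_nonneg _).trans (h i)
  refine (pi_norm_le_iff_of_nonneg hr).2 fun a => ?_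
  have ha : ∀ j, ‖Y j a‖ ≤ r := fun j => (norm_le_pi_norm _ a).trans (h j)
  unfold tokenMix
  split_ifs
  · exact ha i
  · have hcard : (0 : ℝ) < Fintype.card (Tup k n) := by
      exact_mod_cast Fintype.card_pos_iff.2 ⟨i⟩
    rw [norm_mul, norm_inv, Real.norm_natCast, inv_mul_le_iff₀ hcard]
    refine (norm_sum_le_of_le _ fun j _ => ha j).trans_eq ?_
    simp

end TokenMix

theorem Mlp.le_width {a b : ℕ} (M : Mlp a b) : a ≤ M.width ∧ b ≤ M.width := by
  induction M with
  | out A β => simp [Mlp.width]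
  | hidden A β rest ih => exact ⟨le_max_left _ _, ih.2.trans (le_max_right _ _)⟩

/-- The network of two virtual tuple attention layers that applies `θ` to every token, averages the
coordinates that do not satisfy `P` over all tokens with uniform attention weights, and applies
`ψ`. -/
def averagingNet {d c d' : ℕ} (θ : Mlp d c) (P : Fin c → Prop) [DecidablePred P] (ψ : Mlp c d') :
    VTNet d d' :=
  .cons
    { c := c
      p := 1
      inReal := θ
      -- Erases the initial virtual feature, so that after attention the virtual tuple holds exactly
      -- the mean of the tokens.
      inVirtual := .out 0 0
      Q₁ := 0
      K₁ := 0
      V₁ := 1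
      V₂ := 0
      -- Real and virtual tuples keep complementary coordinates, so adding them in the next layer
      -- yields `tokenMix`.
      outReal := .out (Matrix.diagonal fun a => if P a then 1 else 0) 0
      outVirtual := .out (Matrix.diagonal fun a => if P a then 0 else 1) 0 : VTLayer d c } <|
  .cons
    { c := c
      p := 1
      inReal := .out 1 0
      inVirtual := .out 1 0
      Q₁ := 0
      K₁ := 0
      V₁ := 0
      V₂ := 1
      outReal := ψ
      outVirtual := .out 0 0 : VTLayer c d' }
  .nil

section AveragingNet

variable {d c d' : ℕ} (θ : Mlp d c) (P : Fin c → Prop) [DecidablePred P] (ψ : Mlp c d')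

theorem averagingNet_mlpDepth : (averagingNet θ P ψ).mlpDepth ≤ max θ.depth ψ.depth := by
  simp [averagingNet, VTNet.mlpDepth, VTLayer.mlpDepth, Mlp.depth]

theorem averagingNet_width :
    (averagingNet θ P ψ).width ≤ max 1 (max θ.width ψ.width) := by
  have h1 := θ.le_width
  have h2 := ψ.le_width
  simp only [averagingNet, VTNet.width, VTLayer.width, Mlp.width]
  omega

theorem averagingNet_eval (σ : ℝ → ℝ) {k n : ℕ} (X : Tup k n → Fin d → ℝ) (x' : Fin d → ℝ)
    (i : Tup k n) :
    ((averagingNet θ P ψ).eval σ (X, x')).1 i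
      = ψ.eval σ (tokenMix P (fun j => θ.eval σ (X j)) i) := by
  simp only [averagingNet, VTNet.eval, VTLayer.eval, Mlp.eval, vtAttentionReal,
    vtAttentionVirtual, softmax, Matrix.vecMul_zero, Matrix.vecMul_one, add_zero, zero_add,
    dotProduct_zero, Real.exp_zero, Finset.sum_const, Finset.card_univ, nsmul_eq_mul, mul_one]
  congr 1
  ext a
  simp only [Pi.add_apply, Matrix.vecMul_diagonal, Finset.sum_apply, Pi.smul_apply, smul_eq_mul,
    tokenMix, ← Finset.mul_sum]
  split_ifs <;> simp

end AveragingNet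

/-- A continuous function of continuous features of a token and of averages of such features over
all tokens is approximated by virtual tuple attention networks of constant depth and width. The
width does not depend on the matrix that is applied to the tokens first. -/
theorem IsActivation.exists_vtNet_near {σ : ℝ → ℝ} (hσ : IsActivation σ) {α : Type} [Fintype α]
    (d : ℕ) {c d' : ℕ} {g : (α → ℝ) → Fin c → ℝ} (hg : Continuous g)
    {F : (Fin c → ℝ) → Fin d' → ℝ} (hF : Continuous F) (P : Fin c → Prop) [DecidablePred P]
    (R : ℝ) {ε : ℝ} (hε : 0 < ε) :
    ∃ W : ℕ, ∀ B : Matrix (Fin d) α ℝ,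
      ∃ N : VTNet d d', N.numLayers = 2 ∧ N.mlpDepth ≤ 1 ∧ N.width ≤ W ∧
        ∀ (k n : ℕ) (X : Tup k n → Fin d → ℝ) (x' : Fin d → ℝ), (∀ i, ‖X i ᵥ* B‖ ≤ R) →
          ∀ i, ‖(N.eval σ (X, x')).1 i - F (tokenMix P (fun j => g (X j ᵥ* B)) i)‖ ≤ ε := by
  obtain ⟨r, hr⟩ := (isCompact_closedBall (0 : α → ℝ) R).exists_bound_of_continuousOn
    hg.continuousOn
  -- The margin `1` leaves room for the error of the approximated features, since `F` is evaluated
  -- at their mix.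
  have hK := isCompact_closedBall (0 : Fin c → ℝ) (r + 1)
  obtain ⟨δ, hδ, hFδ⟩ := Metric.uniformContinuousOn_iff_le.1
    (hK.uniformContinuousOn_of_continuous hF.continuousOn) (ε / 2) (half_pos hε)
  obtain ⟨h, A, β, C, β', hθ⟩ := hσ.exists_hidden_near (isCompact_closedBall (0 : α → ℝ) R) hg
    (lt_min hδ one_pos)
  obtain ⟨h₂, A₂, β₂, C₂, β₂', hψ⟩ := hσ.exists_hidden_near hK hF (half_pos hε)
  -- `B` is merged into the first weight matrix as `B * A`; the hidden sizes `h` and `h₂` were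
  -- chosen before `B`.
  refine ⟨max 1 (max (max d (max h c)) (max c (max h₂ d'))), fun B =>
    ⟨averagingNet (.hidden (B * A) β (.out C β')) P (.hidden A₂ β₂ (.out C₂ β₂')), rfl,
      (averagingNet_mlpDepth _ _ _).trans (by simp [Mlp.depth]), averagingNet_width _ _ _,
      fun k n X x' hX i => ?_⟩⟩
  rw [averagingNet_eval]
  set Y : Tup k n → Fin c → ℝ := fun j => (Mlp.hidden (B * A) β (.out C β')).eval σ (X j) with hY
  have hmem : ∀ j, X j ᵥ* B ∈ Metric.closedBall (0 : α → ℝ) R := fun j => by simpa using hX j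
  have hYg : ∀ j, ‖Y j - g (X j ᵥ* B)‖ ≤ min δ 1 := fun j => by
    have := hθ _ (hmem j)
    rwa [Matrix.vecMul_vecMul] at this
  have hd : ‖tokenMix P Y i - tokenMix P (fun j => g (X j ᵥ* B)) i‖ ≤ min δ 1 := by
    rw [← tokenMix_sub]
    exact norm_tokenMix_le P hYg i
  have hgr : ‖tokenMix P (fun j => g (X j ᵥ* B)) i‖ ≤ r :=
    norm_tokenMix_le P (fun j => hr _ (hmem j)) i
  have hYr : ‖tokenMix P Y i‖ ≤ r + 1 := by
    have := norm_le_norm_add_norm_sub' (tokenMix P Y i) (tokenMix P (fun j => g (X j ᵥ* B)) i)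
    linarith [min_le_right δ 1]
  have h1 := hψ _ (mem_closedBall_zero_iff.2 hYr)
  have h2 := hFδ _ (mem_closedBall_zero_iff.2 hYr) _
    (mem_closedBall_zero_iff.2 (hgr.trans (by linarith)))
    (by rw [dist_eq_norm]; exact hd.trans (min_le_left _ _))
  rw [dist_eq_norm] at h2
  exact (norm_sub_le_norm_sub_add_norm_sub _ _ _).trans
    ((add_le_add h1 h2).trans_eq (add_halves ε))

/-! ### Kernelized attention -/

theorem norm_le_l2norm {d : ℕ} (x : Fin d → ℝ) : ‖x‖ ≤ l2norm x :=
  (pi_norm_le_iff_of_nonneg (norm_nonneg _)).2 fun a =>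
    PiLp.norm_apply_le (WithLp.toLp 2 x : EuclideanSpace ℝ (Fin d)) a

theorem l2norm_vecMul_le {a b : ℕ} (x : Fin a → ℝ) (A : Matrix (Fin a) (Fin b) ℝ) :
    l2norm (x ᵥ* A) ≤ ‖A‖ * l2norm x := by
  have h := Matrix.l2_opNorm_mulVec Aᵀ (WithLp.toLp 2 x)
  rwa [← Matrix.conjTranspose_eq_transpose_of_trivial, Matrix.l2_opNorm_conjTranspose,
    Matrix.conjTranspose_eq_transpose_of_trivial, Matrix.mulVec_transpose] at h

theorem continuous_l2norm {d : ℕ} : Continuous (l2norm (d := d)) :=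
  (PiLp.continuous_toLp 2 _).norm

section Features

variable {p m d' : ℕ} (φ : (Fin p → ℝ) → Fin m → ℝ)

/-- The features of a token, computed from its query, key and value: the features `φ` of the query,
those of the key, and the tensor product of the latter with the value. -/
def attentionFeatures (u : Fin p ⊕ Fin p ⊕ Fin d' → ℝ) : Fin m ⊕ Fin m ⊕ Fin m × Fin d' → ℝ :=
  Sum.elim (φ fun a => u (.inl a)) (Sum.elim (φ fun a => u (.inr (.inl a)))
    fun q => φ (fun a => u (.inr (.inl a))) q.1 * u (.inr (.inr q.2)))

theorem continuous_attentionFeatures {φ : (Fin p → ℝ) → Fin m → ℝ} (hφ : Continuous φ) :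
    Continuous (attentionFeatures (d' := d') φ) := by
  have h1 : Continuous fun u : Fin p ⊕ Fin p ⊕ Fin d' → ℝ => φ fun a => u (.inl a) :=
    hφ.comp (by fun_prop)
  have h2 : Continuous fun u : Fin p ⊕ Fin p ⊕ Fin d' → ℝ => φ fun a => u (.inr (.inl a)) :=
    hφ.comp (by fun_prop)
  refine continuous_pi fun r => ?_
  rcases r with a | a | q
  · exact (continuous_apply a).comp h1
  · exact (continuous_apply a).comp h2
  · exact ((continuous_apply q.1).comp h2).mul (continuous_apply _)

/-- The quotient that computes attention from the features of a query and the averaged features of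
the keys and values, with denominators below `δ` replaced by `δ`. -/
def attentionQuotient (δ : ℝ) (y : Fin m ⊕ Fin m ⊕ Fin m × Fin d' → ℝ) : Fin d' → ℝ := fun c =>
  (∑ a, y (.inl a) * y (.inr (.inr (a, c)))) / max (∑ a, y (.inl a) * y (.inr (.inl a))) δ

theorem continuous_attentionQuotient {δ : ℝ} (hδ : 0 < δ) :
    Continuous (attentionQuotient (m := m) (d' := d') δ) :=
  continuous_pi fun c => Continuous.div (by fun_prop) (by fun_prop)
    fun _ => (hδ.trans_le (le_max_right _ _)).ne'

/-- The number of tokens cancels from the fraction. The averaged denominator is a mean of terms that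
are at least `δ`, so the cutoff is inactive. -/
theorem kernelAttention_eq_attentionQuotient {d k n : ℕ} {Q K : Matrix (Fin d) (Fin p) ℝ}
    {V : Matrix (Fin d) (Fin d') ℝ} {X : Tup k n → Fin d → ℝ} {δ : ℝ}
    (hδ : ∀ i j, δ ≤ φ (X i ᵥ* Q) ⬝ᵥ φ (X j ᵥ* K)) (i : Tup k n) :
    kernelAttention φ Q K V X i = attentionQuotient δ (tokenMix (fun r => r.isLeft = true)
      (fun j => attentionFeatures φ
        (Sum.elim (X j ᵥ* Q) (Sum.elim (X j ᵥ* K) (X j ᵥ* V)))) i) := by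
  have hcard : (0 : ℝ) < Fintype.card (Tup k n) := by
    exact_mod_cast Fintype.card_pos_iff.2 ⟨i⟩
  set z : ℝ := (Fintype.card (Tup k n) : ℝ) with hz
  set q := φ (X i ᵥ* Q) with hq
  have hnum : ∀ c, (q ᵥ* ∑ j, Matrix.vecMulVec (φ (X j ᵥ* K)) (X j ᵥ* V)) c
      = z * ∑ a, q a * (z⁻¹ * ∑ j, φ (X j ᵥ* K) a * (X j ᵥ* V) c) := by
    intro c
    rw [Finset.mul_sum, Matrix.vecMul, dotProduct]
    refine Finset.sum_congr rfl fun a _ => ?_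
    rw [Matrix.sum_apply]
    simp only [Matrix.vecMulVec_apply]
    field_simp
  have hden : q ⬝ᵥ ∑ j, φ (X j ᵥ* K) = z * ∑ a, q a * (z⁻¹ * ∑ j, φ (X j ᵥ* K) a) := by
    rw [Finset.mul_sum, dotProduct]
    refine Finset.sum_congr rfl fun a _ => ?_
    rw [Finset.sum_apply]
    field_simp
  have hle : δ ≤ ∑ a, q a * (z⁻¹ * ∑ j, φ (X j ᵥ* K) a) := by
    rw [← mul_le_mul_iff_right₀ hcard, ← hden, dotProduct_sum]
    refine le_trans (le_of_eq ?_) (Finset.sum_le_sum fun j _ => hδ i j)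
    simp [hz]
  ext c
  have hR : attentionQuotient δ (tokenMix (fun r => r.isLeft = true)
      (fun j => attentionFeatures φ
        (Sum.elim (X j ᵥ* Q) (Sum.elim (X j ᵥ* K) (X j ᵥ* V)))) i) c
      = (∑ a, q a * (z⁻¹ * ∑ j, φ (X j ᵥ* K) a * (X j ᵥ* V) c)) /
        max (∑ a, q a * (z⁻¹ * ∑ j, φ (X j ᵥ* K) a)) δ := by
    simp [attentionQuotient, tokenMix, attentionFeatures, hq, hz]
  rw [hR, max_eq_left hle, kernelAttention, hnum, hden, mul_div_mul_left _ _ hcard.ne']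

/-- Kernelized attention with a continuous positive feature map is approximated by virtual tuple
attention of constant depth and width. -/
theorem approximableByVT_of_continuous_of_pos {σ : ℝ → ℝ} (hσ : IsActivation σ) (d : ℕ)
    (hφ : Continuous φ) (hpos : ∀ x a, 0 < φ x a) (hm : 0 < m) :
    ApproximableByVT σ d d' φ := by
  intro C₁ C₂ ε hε
  set R : ℝ := |C₂| * |C₁| with hR
  have hR0 : 0 ≤ R := by positivity
  -- The kernel is continuous and positive, hence has a positive minimum on the compact product of
  -- balls; positivity needs `m > 0`.
  obtain ⟨δ, hδ, hδle⟩ : ∃ δ : ℝ, 0 < δ ∧ ∀ x y : Fin p → ℝ, ‖x‖ ≤ R → ‖y‖ ≤ R →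
      δ ≤ φ x ⬝ᵥ φ y := by
    have hK := (isCompact_closedBall (0 : Fin p → ℝ) R).prod
      (isCompact_closedBall (0 : Fin p → ℝ) R)
    obtain ⟨z, -, hz⟩ := hK.exists_isMinOn
      ⟨(0, 0), by simpa using hR0⟩ (f := fun z => φ z.1 ⬝ᵥ φ z.2)
      (by unfold dotProduct; fun_prop)
    refine ⟨φ z.1 ⬝ᵥ φ z.2, Finset.sum_pos (fun a _ => mul_pos (hpos _ a) (hpos _ a))
      ⟨⟨0, hm⟩, Finset.mem_univ _⟩, fun x y hx hy => ?_⟩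
    exact hz (a := (x, y)) ⟨by simpa using hx, by simpa using hy⟩
  -- The approximation results use the sup norm; `η` converts to the Euclidean norm.
  obtain ⟨η, hη, hηε⟩ : ∃ η : ℝ, 0 < η ∧ ∀ x : Fin d' → ℝ, ‖x‖ ≤ η → l2norm x < ε := by
    obtain ⟨η, hη, h⟩ := Metric.continuousAt_iff.1
      ((continuous_l2norm (d := d')).continuousAt (x := 0)) ε hε
    refine ⟨η / 2, half_pos hη, fun x hx => ?_⟩
    have := h (x := x) (by rw [dist_zero_right]; linarith)
    rw [Real.dist_eq] at this
    simpa [l2norm] using this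
  let e := (Fintype.equivFin (Fin m ⊕ Fin m ⊕ Fin m × Fin d')).symm
  have hg : Continuous fun (u : Fin p ⊕ Fin p ⊕ Fin d' → ℝ) r => attentionFeatures φ u (e r) :=
    continuous_pi fun r => (continuous_apply _).comp (continuous_attentionFeatures hφ)
  have hF : Continuous fun y : Fin _ → ℝ => attentionQuotient (m := m) (d' := d') δ fun r => y (e.symm r) :=
    (continuous_attentionQuotient hδ).comp (by fun_prop)
  -- The `isLeft` coordinates are the query features, which stay with their token; key and key-value
  -- features are averaged.
  obtain ⟨W, hW⟩ := hσ.exists_vtNet_near d hg hF (fun r => (e r).isLeft = true) R hη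
  refine ⟨W, fun Q K V hQ hK hV => ?_⟩
  obtain ⟨N, h1, h2, h3, h4⟩ := hW (Matrix.fromCols Q (Matrix.fromCols K V))
  refine ⟨N, h1, h2, h3, fun k n X x' hX i => hηε _ ?_⟩
  have hbound : ∀ {b : ℕ} (A : Matrix (Fin d) (Fin b) ℝ), ‖A‖ < C₂ → ∀ j, ‖X j ᵥ* A‖ ≤ R :=
    fun A hA j => (norm_le_l2norm _).trans <| (l2norm_vecMul_le _ _).trans <|
      mul_le_mul (hA.le.trans (le_abs_self _)) ((hX j).le.trans (le_abs_self _)) (norm_nonneg _)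
        (abs_nonneg _)
  have h5 := h4 k n X x' (fun j => by
    rw [Matrix.vecMul_fromCols, Matrix.vecMul_fromCols, pi_norm_le_iff_of_nonneg hR0]
    rintro (a | a | a)
    · exact (norm_le_pi_norm _ a).trans (hbound Q hQ j)
    · exact (norm_le_pi_norm _ a).trans (hbound K hK j)
    · exact (norm_le_pi_norm _ a).trans (hbound V hV j)) i
  rw [kernelAttention_eq_attentionQuotient φ
    (fun i j => hδle _ _ (hbound Q hQ i) (hbound K hK j)) i]
  simp only [tokenMix, Matrix.vecMul_fromCols, Equiv.apply_symm_apply] at h5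
  exact h5

end Features

/-! ### Continuity and positivity of the two feature maps -/

theorem continuous_elu : Continuous elu := by
  refine Continuous.if (fun t ht => ?_) continuous_id (by fun_prop)
  have : t = 0 := by
    have := frontier_lt_subset_eq continuous_const continuous_id ht
    exact this.symm
  simp [this]

theorem neg_one_lt_elu (t : ℝ) : -1 < elu t := by
  unfold elu
  split_ifs
  · linarith
  · linarith [Real.exp_pos t]

theorem continuous_linearFeature {p : ℕ} : Continuous (linearFeature (p := p)) :=
  continuous_pi fun a => (continuous_elu.comp (continuous_apply a)).add continuous_const

theorem continuous_performerFeature {p m : ℕ} (w : Fin m → Fin p → ℝ) :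
    Continuous (performerFeature w) := by
  have := continuous_l2norm (d := p)
  refine continuous_pi fun a => ?_
  unfold performerFeature dotProduct
  fun_prop

end

theorem mainTheorem6 (σ : ℝ → ℝ) (hσ : IsActivation σ) (d d' p : ℕ)
    (hd : 0 < d) (hd' : 0 < d') (hp : 0 < p) :
    (∀ (m : ℕ) (w : Fin m → Fin p → ℝ), 0 < m → ApproximableByVT σ d d' (performerFeature w)) ∧
      ApproximableByVT σ d d' (linearFeature (p := p)) := by
  refine ⟨fun m w hm => ?_, ?_⟩
  · refine approximableByVT_of_continuous_of_pos _ hσ d (continuous_performerFeature w)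
      (fun x a => ?_) hm
    have : (0 : ℝ) < m := by exact_mod_cast hm
    unfold performerFeature
    positivity
  · exact approximableByVT_of_continuous_of_pos _ hσ d continuous_linearFeature
      (fun x a => by have := neg_one_lt_elu (x a); unfold linearFeature; linarith) hp
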